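/- Let $N$ (players) and $R$ (resources) be finite sets. For each player $i \in N$ let $f^{(i)} : 2^R \to \mathbb{N}$ be an integral polymatroid rank function, i.e. $f^{(i)}(\emptyset)=0$, $f^{(i)}(U) \le f^{(i)}(V)$ whenever $U \subseteq V \subseteq R$, and $f^{(i)}(U\cup V)+f^{(i)}(U\cap V)\le f^{(i)}(U)+f^{(i)}(V)$ for all $U,V\subseteq R$; let $d_i \in \mathbb{N}$ be a demand with $d_i \le f^{(i)}(R)$; and for each $r \in R$ let $c_{i,r} : \mathbb{N} \to \mathbb{R}$ be a cost function (in particular, integer-valued cost functions are allowed). In the associated congestion game on integral polymatroids, the strategy set of player $i$ is the integral polymatroid base polyhedron $$X_i = \Bigl\{ x_i \in \mathbb{N}^R \;\Big|\; \sum_{r \in U} x_{i,r} \le f^{(i)}(U) \text{ for all } U \subseteq R,\ \sum_{r\in R} x_{i,r} = d_i \Bigr\},$$ and the private cost of player $i$ under a strategy profile $x = (x_j)_{j\in N} \in \prod_{j \in N} X_j$ is $\pi_i(x) = \sum_{r\in R} c_{i,r}(x_r)\, x_{i,r}$, where $x_r = \sum_{j \in N} x_{j,r}$. Assume that for all $i\in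 N$ and $r\in R$ the function $c_{i,r}$ is nonnegative, nondecreasing and $u_{i,r}$-truncated strongly semi-convex with $u_{i,r} = f^{(i)}(\{r\})$, i.e. $$c_{i,r}(a+x)\,x - c_{i,r}(a+x-1)\,(x-1) \;\le\; c_{i,r}(b+y)\,y - c_{i,r}(b+y-1)\,(y-1)$$ for all integers $1\le x\le y\le u_{i,r}$ and $0 \le a\le b$. (This holds in particular if every $c_{i,r}$ is strongly semi-convex, i.e. satisfies the inequality for all integers $1\le x\le y$ and $0\le a\le b$.) Then the game has a pure Nash equilibrium: there is a strategy profile $x \in \prod_{j\in N} X_j$ such that $\pi_i(x) \le \pi_i(y_i, x_{-i})$ for every player $i\in N$ and every $y_i\in X_i$. -/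

import Mathlib

open scoped BigOperators

/-- `f : 2^R → ℕ` is an integral polymatroid rank function: normalized, monotone, submodular. -/
structure IsPolymatroidRank {R : Type*} [DecidableEq R] (f : Finset R → ℕ) : Prop where
  normalized : f ∅ = 0
  monotone : ∀ U V : Finset R, U ⊆ V → f U ≤ f V
  submodular : ∀ U V : Finset R, f (U ∪ V) + f (U ∩ V) ≤ f U + f V

/-- The integral polyhedron `P_f`. -/
def integralPolyhedron {R : Type*} (f : Finset R → ℕ) : Set (R → ℕ) :=
  {x | ∀ U : Finset R, ∑ r ∈ U, x r ≤ f U}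

/-- The `d`-truncated integral polymatroid `P_f(d)`. -/
def truncatedPolymatroid {R : Type*} [Fintype R] (f : Finset R → ℕ) (d : ℕ) : Set (R → ℕ) :=
  {x | x ∈ integralPolyhedron f ∧ ∑ r, x r ≤ d}

/-- The integral polymatroid base polyhedron `B_f(d)`. -/
def basePolyhedron {R : Type*} [Fintype R] (f : Finset R → ℕ) (d : ℕ) : Set (R → ℕ) :=
  {x | x ∈ integralPolyhedron f ∧ ∑ r, x r = d}

theorem basePolyhedron_subset_truncatedPolymatroid {R : Type*} [Fintype R]
    (f : Finset R → ℕ) (d : ℕ) : basePolyhedron f d ⊆ truncatedPolymatroid f d :=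
  fun _ hx => ⟨hx.1, hx.2.le⟩

/-- Strong semi-convexity:
`c(a+x) x - c(a+x-1) (x-1) ≤ c(b+y) y - c(b+y-1) (y-1)` for all `1 ≤ x ≤ y` and `a ≤ b`.
The subtractions inside the arguments of `c` are never truncated, since `1 ≤ x` and `1 ≤ y`. -/
def StronglySemiConvex (c : ℕ → ℝ) : Prop :=
  ∀ x y a b : ℕ, 1 ≤ x → x ≤ y → a ≤ b →
    c (a + x) * (x : ℝ) - c (a + x - 1) * ((x : ℝ) - 1)
      ≤ c (b + y) * (y : ℝ) - c (b + y - 1) * ((y : ℝ) - 1)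

/-- `u`-truncated strong semi-convexity: the inequality is only required for `1 ≤ x ≤ y ≤ u`. -/
def TruncatedStronglySemiConvex (u : ℕ) (c : ℕ → ℝ) : Prop :=
  ∀ x y a b : ℕ, 1 ≤ x → x ≤ y → y ≤ u → a ≤ b →
    c (a + x) * (x : ℝ) - c (a + x - 1) * ((x : ℝ) - 1)
      ≤ c (b + y) * (y : ℝ) - c (b + y - 1) * ((y : ℝ) - 1)

theorem StronglySemiConvex.truncated {c : ℕ → ℝ} (h : StronglySemiConvex c) (u : ℕ) :
    TruncatedStronglySemiConvex u c :=
  fun x y a b hx hxy _ hab => h x y a b hx hxy hab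

/-- A congestion game on integral polymatroids with players `N` and resources `R`: every player `i`
has a demand `d_i`, an integral polymatroid rank function `f^(i)` with `d_i ≤ f^(i)(R)`, and a cost
function `c_{i,r}` for each resource `r`. -/
structure PolymatroidCongestionGame (N R : Type*) [Fintype R] [DecidableEq R] where
  demand : N → ℕ
  rank : N → Finset R → ℕ
  cost : N → R → ℕ → ℝ
  isPolymatroidRank : ∀ i, IsPolymatroidRank (rank i)
  demand_le : ∀ i, demand i ≤ rank i Finset.univ

namespace PolymatroidCongestionGame

variable {N R : Type*} [Fintype N] [DecidableEq N] [Fintype R] [DecidableEq R]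

/-- The strategy set `X_i = B_{f^(i)}(d_i)`. -/
def strategies (G : PolymatroidCongestionGame N R) (i : N) : Set (R → ℕ) :=
  basePolyhedron (G.rank i) (G.demand i)

/-- The total load `x_r = ∑ i, x_{i,r}`. -/
def load (x : N → R → ℕ) (r : R) : ℕ := ∑ i, x i r

/-- The private cost `π_i(x) = ∑ r, c_{i,r}(x_r) x_{i,r}`. -/
noncomputable def privateCost (G : PolymatroidCongestionGame N R) (i : N) (x : N → R → ℕ) : ℝ :=
  ∑ r, G.cost i r (load x r) * (x i r : ℝ)

/-- `z` is a best response of player `i` to `x_{-i}` (the row `x i` is overwritten everywhere,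
so it plays no role). -/
def IsBestResponse (G : PolymatroidCongestionGame N R) (i : N) (x : N → R → ℕ)
    (z : R → ℕ) : Prop :=
  z ∈ G.strategies i ∧ ∀ y ∈ G.strategies i,
    G.privateCost i (Function.update x i z) ≤ G.privateCost i (Function.update x i y)

/-- A pure Nash equilibrium: a strategy profile in which every player's strategy is a best
response to the strategies of the others. -/
def IsPureNashEquilibrium (G : PolymatroidCongestionGame N R) (x : N → R → ℕ) : Prop :=
  (∀ i, x i ∈ G.strategies i) ∧ ∀ i, G.IsBestResponse i x (x i)

end PolymatroidCongestionGame

/-!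
The marginal costs of a player on a resource are nondecreasing in the load and in the number of
units the player holds there, so on an M-convex strategy set a strategy is a best response as soon
as no exchange of a single unit is profitable. Equilibria are built by raising the demands one unit
at a time. The new unit is placed greedily; it is then a token, and all other players ignore it when
they evaluate the loads. With the loads frozen in this way, only a unit next to the token can want
to move, and moving it moves the token but leaves the loads unchanged. A state that minimizes the
sum over all players of the separable costs at the frozen loads therefore stays stable once the
token is counted as part of the load.

Both the greedy step and the token step preserve stability because stability with respect to
distinct costs `a ≤ b` of giving up and of acquiring a unit is optimality for one separable convex
function: charge the units in use according to `a` and all further units according to `b`.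
-/

section MConvex

variable {R M : Type*}

/-- The separable objective in which the `(k + 1)`-st unit of `r` costs `w r k`. -/
def separableCost [Fintype R] [AddCommMonoid M] (w : R → ℕ → M) (x : R → ℕ) : M :=
  ∑ r, ∑ k ∈ Finset.range (x r), w r k

/-- The weights that charge the units of `x` according to `a` and all further units according
to `b`. -/
def splitWeight (a b : R → ℕ → M) (x : R → ℕ) (r : R) (k : ℕ) : M :=
  if k < x r then a r k else b r k

theorem monotoneOn_splitWeight [Preorder M] {u : R → ℕ} {a b : R → ℕ → M}
    (ha : ∀ r, MonotoneOn (a r) (Set.Iio (u r)))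
    (hb : ∀ r, MonotoneOn (b r) (Set.Iio (u r))) (hab : ∀ r, ∀ k < u r, a r k ≤ b r k)
    (x : R → ℕ) (r : R) : MonotoneOn (splitWeight a b x r) (Set.Iio (u r)) := by
  intro j hj k hk hjk
  unfold splitWeight
  split_ifs with h₁ h₂
  · exact ha r hj hk hjk
  · exact (ha r hj hk hjk).trans (hab r k hk)
  · omega
  · exact hb r hj hk hjk

variable [DecidableEq R]

theorem exists_eq_add_single {y : R → ℕ} {q : R} (hq : 0 < y q) :
    ∃ z : R → ℕ, y = z + Pi.single q 1 :=
  ⟨y - Pi.single q 1, (tsub_add_cancel_of_le (update_le_iff.2 ⟨hq, by simp⟩)).symm⟩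

/-- M-convexity of a set of integral vectors, i.e. the symmetric exchange property: whenever
`x + e_p` and `y` belong to `B` and `x + e_p` exceeds `y` at `p`, some `q` at which `y` exceeds
`x + e_p` can be traded for `p` in both vectors. All vectors losing a unit are written as sums, so
that no subtraction of natural numbers occurs. -/
def MConvex (B : Set (R → ℕ)) : Prop :=
  ∀ ⦃x y : R → ℕ⦄ ⦃p : R⦄, x + Pi.single p 1 ∈ B → y ∈ B → y p ≤ x p →
    ∃ (z : R → ℕ) (q : R), y = z + Pi.single q 1 ∧ q ≠ p ∧ x q ≤ z q ∧
      x + Pi.single q 1 ∈ B ∧ z + Pi.single p 1 ∈ B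

/-- No single unit of `x` can be moved inside `B` at a profit, if giving up the `(k + 1)`-st unit
of `r` saves `a r k` and acquiring it costs `b r k`. -/
def ExchangeStable [LE M] (B : Set (R → ℕ)) (a b : R → ℕ → M) (x : R → ℕ) : Prop :=
  ∀ ⦃z : R → ℕ⦄ ⦃p q : R⦄, x = z + Pi.single p 1 → z + Pi.single q 1 ∈ B → a p (z p) ≤ b q (z q)

theorem separableCost_add_single [Fintype R] [AddCommMonoid M] (w : R → ℕ → M)
    (x : R → ℕ) (p : R) :
    separableCost w (x + Pi.single p 1) = separableCost w x + w p (x p) := by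
  have h (r : R) : ∑ k ∈ Finset.range (x r + Pi.single (M := fun _ => ℕ) p 1 r), w r k =
      ∑ k ∈ Finset.range (x r), w r k + if r = p then w p (x p) else 0 := by
    obtain rfl | hr := eq_or_ne r p <;> simp_all [Finset.sum_range_succ]
  simp [separableCost, h, Finset.sum_add_distrib]

theorem separableCost_splitWeight [Fintype R] [AddCommGroup M] (a b : R → ℕ → M)
    (z y : R → ℕ) (t : R) :
    separableCost (splitWeight a b z) y = separableCost (splitWeight a b (z + Pi.single t 1)) y +
      if z t < y t then b t (z t) - a t (z t) else 0 := by
  have h (r : R) (k : ℕ) : splitWeight a b z r k = splitWeight a b (z + Pi.single t 1) r k +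
      if r = t then if k = z t then b t (z t) - a t (z t) else 0 else 0 := by
    obtain rfl | hr := eq_or_ne r t
    · obtain hk | rfl | hk := lt_trichotomy k (z r)
      · simp [splitWeight, hk, hk.ne, hk.trans (Nat.lt_succ_self _)]
      · simp [splitWeight]
      · simp [splitWeight, hk.not_gt, hk.ne', (Nat.succ_le_of_lt hk).not_gt]
    · simp [splitWeight, hr]
  simp only [separableCost, h, Finset.sum_add_distrib]
  rw [Fintype.sum_eq_single (f := fun r => ∑ k ∈ Finset.range (y r), ite (r = t) _ _) t
    fun r hr => by simp [hr]]
  simp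

theorem MConvex.eq_of_le {B : Set (R → ℕ)} (hB : MConvex B) {x y : R → ℕ} (hx : x ∈ B) (hy : y ∈ B)
    (hle : x ≤ y) : x = y := by
  by_contra hne
  obtain ⟨-, p, hp⟩ := Pi.lt_def.1 (hle.lt_of_ne hne)
  obtain ⟨y, rfl⟩ := exists_eq_add_single (Nat.zero_lt_of_lt hp)
  obtain ⟨x, q, rfl, hqp, hyx, -⟩ := hB hy hx (by simpa [Nat.lt_succ_iff] using hp)
  have hxy : x q + 1 ≤ y q := by simpa [hqp] using hle q
  omega

variable {B : Set (R → ℕ)} {u x y z : R → ℕ} {a b w : R → ℕ → M} {p s t : R}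

theorem lt_of_add_single_mem (hu : B ⊆ Set.Iic u) (h : z + Pi.single p 1 ∈ B) : z p < u p := by
  simpa using hu h p

theorem ExchangeStable.mono [Preorder M] (hu : B ⊆ Set.Iic u) (hx : x ∈ B)
    (haw : ∀ r, ∀ k < u r, a r k ≤ w r k) (hwb : ∀ r, ∀ k < u r, w r k ≤ b r k)
    (h : ExchangeStable B w w x) : ExchangeStable B a b x := by
  rintro z p q rfl hq
  exact (haw p _ (lt_of_add_single_mem hu hx)).trans
    ((h rfl hq).trans (hwb q _ (lt_of_add_single_mem hu hq)))

theorem ExchangeStable.self_splitWeight [Preorder M] (h : ExchangeStable B a b x) :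
    ExchangeStable B (splitWeight a b x) (splitWeight a b x) x := by
  rintro z p q rfl hq
  obtain rfl | hqp := eq_or_ne q p
  · rfl
  · simpa [splitWeight, hqp] using h rfl hq

variable [AddCommGroup M] [Preorder M] [IsOrderedAddMonoid M]

section Fintype

variable [Fintype R]

theorem exchangeStable_of_isMinOn (h : IsMinOn (separableCost w) B x) :
    ExchangeStable B w w x := by
  rintro z p q rfl hq
  simpa [separableCost_add_single] using h hq

/-- Moving a unit of `y` to a resource on which `x` exceeds `y` brings `y` closer to `x`; by
convexity and the stability of `x` it does not increase the cost. -/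
theorem ExchangeStable.isMinOn (hB : MConvex B) (hu : B ⊆ Set.Iic u)
    (hw : ∀ r, MonotoneOn (w r) (Set.Iio (u r))) (hx : x ∈ B) (h : ExchangeStable B w w x) :
    IsMinOn (separableCost w) B x := by
  intro y hy
  induction hd : x - y using WellFoundedLT.induction generalizing y with
  | _ d ih =>
  subst hd
  by_cases hxy : x ≤ y
  · rw [hB.eq_of_le hx hy hxy]
    exact le_rfl
  obtain ⟨p, hp⟩ : ∃ p, y p < x p := by simpa [Pi.le_def] using hxy
  obtain ⟨x, rfl⟩ := exists_eq_add_single (Nat.zero_lt_of_lt hp)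
  obtain ⟨y, q, rfl, hqp, hxy, hxq, hyp⟩ := hB hx hy (by simpa [Nat.lt_succ_iff] using hp)
  have hyx : y p ≤ x p := by simpa [hqp.symm, Nat.lt_succ_iff] using hp
  have hcloser : x + Pi.single p 1 - (y + Pi.single p 1) <
      x + Pi.single p 1 - (y + Pi.single q 1) := by
    rw [add_tsub_add_eq_tsub_right, Pi.lt_def]
    refine ⟨fun r => ?_, p, ?_⟩
    · obtain rfl | hrq := eq_or_ne r q
      · simp [tsub_eq_zero_of_le hxy]
      · simpa [hrq] using tsub_le_tsub_right (Nat.le_add_right _ _) _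
    · simp [hqp.symm, Nat.sub_add_comm hyx]
  calc separableCost w (x + Pi.single p 1)
    _ ≤ separableCost w (y + Pi.single p 1) := ih _ hcloser hyp rfl
    _ = separableCost w y + w p (y p) := separableCost_add_single ..
    _ ≤ separableCost w y + w p (x p) := by
      gcongr
      exact hw p (lt_of_add_single_mem hu hyp) (lt_of_add_single_mem hu hx) (by omega)
    _ ≤ separableCost w y + w q (x q) := by
      gcongr
      exact h rfl hxq
    _ ≤ separableCost w y + w q (y q) := by
      gcongr
      exact hw q (lt_of_add_single_mem hu hxq) (lt_of_add_single_mem hu hy) hxy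
    _ = separableCost w (y + Pi.single q 1) := (separableCost_add_single ..).symm

theorem ExchangeStable.isMinOn_splitWeight (hB : MConvex B) (hu : B ⊆ Set.Iic u)
    (ha : ∀ r, MonotoneOn (a r) (Set.Iio (u r))) (hb : ∀ r, MonotoneOn (b r) (Set.Iio (u r)))
    (hab : ∀ r, ∀ k < u r, a r k ≤ b r k) (hx : x ∈ B) (h : ExchangeStable B a b x) :
    IsMinOn (separableCost (splitWeight a b x)) B x :=
  h.self_splitWeight.isMinOn hB hu (monotoneOn_splitWeight ha hb hab x) hx

theorem exchangeStable_of_isMinOn_splitWeight (hu : B ⊆ Set.Iic u)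
    (hab : ∀ r, ∀ k < u r, a r k ≤ b r k) (hx : x ∈ B)
    (h : IsMinOn (separableCost (splitWeight a b y)) B x) : ExchangeStable B a b x := by
  refine (exchangeStable_of_isMinOn h).mono hu hx (fun r k hk => ?_) (fun r k hk => ?_) <;>
    unfold splitWeight <;> split_ifs <;> first | rfl | exact hab r k hk

end Fintype

theorem ExchangeStable.add_single_of_forall_le [Finite R] (hB : MConvex B) (hu : B ⊆ Set.Iic u)
    (ha : ∀ r, MonotoneOn (a r) (Set.Iio (u r))) (hb : ∀ r, MonotoneOn (b r) (Set.Iio (u r)))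
    (hab : ∀ r, ∀ k < u r, a r k ≤ b r k) (ht : z + Pi.single t 1 ∈ B)
    (h : ExchangeStable B a b (z + Pi.single t 1)) (hs : z + Pi.single s 1 ∈ B)
    (hmin : ∀ q, z + Pi.single q 1 ∈ B → b s (z s) ≤ b q (z q)) :
    ExchangeStable B a b (z + Pi.single s 1) := by
  have := Fintype.ofFinite R
  refine exchangeStable_of_isMinOn_splitWeight (y := z) hu hab hs fun y hy => ?_
  set W := separableCost (splitWeight a b (z + Pi.single t 1)) with hW
  have hopt : IsMinOn W B (z + Pi.single t 1) := h.isMinOn_splitWeight hB hu ha hb hab ht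
  have hWt : W (z + Pi.single t 1) = W z + a t (z t) := by
    simp [W, separableCost_add_single, splitWeight]
  suffices hgoal : W z + b s (z s) ≤ separableCost (splitWeight a b z) y by
    simpa [separableCost_add_single, separableCost_splitWeight a b z z t, splitWeight] using hgoal
  rw [separableCost_splitWeight a b z y t, ← hW]
  split_ifs with hyt
  · calc W z + b s (z s)
      _ ≤ W z + b t (z t) := add_le_add_right (hmin t ht) _
      _ = W (z + Pi.single t 1) + (b t (z t) - a t (z t)) := by rw [hWt]; abel
      _ ≤ W y + (b t (z t) - a t (z t)) := add_le_add_left (hopt hy) _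
  · obtain ⟨y, q, rfl, hqt, hqy, hq, hp⟩ := hB ht hy (not_lt.1 hyt)
    have hyt : y t ≤ z t := by simpa [hqt.symm] using hyt
    have hWy : W (y + Pi.single t 1) = W y + a t (y t) := by
      simp [W, separableCost_add_single, splitWeight, hyt]
    have hzy : W z ≤ W y := by
      have hle : W z + a t (z t) ≤ W y + a t (y t) := hWt ▸ hWy ▸ hopt hp
      have hat := ha t (lt_of_add_single_mem hu hp) (lt_of_add_single_mem hu ht) hyt
      exact le_of_add_le_add_right (hle.trans (add_le_add_right hat _))
    calc W z + b s (z s)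
      _ ≤ W y + b q (y q) := add_le_add hzy <| (hmin q hq).trans <|
        hb q (lt_of_add_single_mem hu hq) (lt_of_add_single_mem hu hy) hqy
      _ = W (y + Pi.single q 1) + 0 := by
        simp [W, separableCost_add_single, splitWeight, hqt, hqy.not_gt]

end MConvex

section Polymatroid

variable {R : Type*} {f : Finset R → ℕ} {d : ℕ} {x y : R → ℕ}

theorem basePolyhedron_subset_Iic [Fintype R] : basePolyhedron f d ⊆ Set.Iic fun r => f {r} :=
  fun _ hx r => by simpa using hx.1 {r}

theorem basePolyhedron_min [Fintype R] (f : Finset R → ℕ) (d : ℕ) :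
    basePolyhedron (fun U => min (f U) d) d = basePolyhedron f d := by
  ext x
  refine ⟨fun h => ⟨fun U => (h.1 U).trans (min_le_left _ _), h.2⟩,
    fun h => ⟨fun U => le_min (h.1 U) ?_, h.2⟩⟩
  rw [← h.2]
  exact Finset.sum_le_sum_of_subset (Finset.subset_univ U)

/-- The rank constraint of `x` at `U` holds with equality. -/
def IsTight (f : Finset R → ℕ) (x : R → ℕ) (U : Finset R) : Prop :=
  ∑ r ∈ U, x r = f U

variable [DecidableEq R] {p q : R}

theorem IsPolymatroidRank.min_const (hf : IsPolymatroidRank f) (d : ℕ) :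
    IsPolymatroidRank fun U => min (f U) d where
  normalized := by simp [hf.normalized]
  monotone U V h := min_le_min_right _ (hf.monotone U V h)
  submodular U V := by
    have := hf.submodular U V
    have := hf.monotone _ _ (Finset.subset_union_left (s₁ := U) (s₂ := V))
    have := hf.monotone _ _ (Finset.subset_union_right (s₁ := U) (s₂ := V))
    have := hf.monotone _ _ (Finset.inter_subset_left (s₁ := U) (s₂ := V))
    have := hf.monotone _ _ (Finset.inter_subset_right (s₁ := U) (s₂ := V))
    omega

theorem isSublattice_isTight (hf : IsPolymatroidRank f) (hx : x ∈ integralPolyhedron f) :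
    IsSublattice {U | IsTight f x U} := by
  have h {U V : Finset R} (hU : IsTight f x U) (hV : IsTight f x V) :
      IsTight f x (U ∪ V) ∧ IsTight f x (U ∩ V) := by
    unfold IsTight at *
    have := hf.submodular U V
    have := hx (U ∪ V)
    have := hx (U ∩ V)
    have := Finset.sum_union_inter (s₁ := U) (s₂ := V) (f := x)
    omega
  exact ⟨fun U hU V hV => (h hU hV).1, fun U hU V hV => (h hU hV).2⟩

theorem sum_add_single (x : R → ℕ) (q : R) (U : Finset R) :
    ∑ r ∈ U, (x + Pi.single q 1 : R → ℕ) r = ∑ r ∈ U, x r + if q ∈ U then 1 else 0 := by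
  simp [Finset.sum_add_distrib]

theorem mem_integralPolyhedron_of_add_single (h : x + Pi.single q 1 ∈ integralPolyhedron f) :
    x ∈ integralPolyhedron f :=
  fun U => (Finset.sum_le_sum fun r _ => Nat.le_add_right (x r) _).trans (h U)

theorem exists_isTight_of_add_single_notMem (hx : x ∈ integralPolyhedron f)
    (hq : x + Pi.single q 1 ∉ integralPolyhedron f) : ∃ U, q ∈ U ∧ IsTight f x U := by
  obtain ⟨U, hU⟩ : ∃ U, f U < ∑ r ∈ U, (x + Pi.single q 1 : R → ℕ) r := by
    simpa only [integralPolyhedron, Set.mem_ofPred_eq, not_forall, not_le] using hq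
  have hxU := hx U
  rw [sum_add_single] at hU
  split_ifs at hU with hqU
  · exact ⟨U, hqU, hxU.antisymm (Nat.lt_succ_iff.1 hU)⟩
  · omega

theorem exists_isTight_superset (hf : IsPolymatroidRank f) (hx : x ∈ integralPolyhedron f)
    {A : Finset R} (hA : ∀ q ∈ A, x + Pi.single q 1 ∉ integralPolyhedron f) :
    ∃ U, A ⊆ U ∧ IsTight f x U := by
  obtain rfl | hne := A.eq_empty_or_nonempty
  · exact ⟨∅, subset_rfl, by simp [IsTight, hf.normalized]⟩
  choose! U hqU hU using fun q hq => exists_isTight_of_add_single_notMem hx (hA q hq)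
  exact ⟨A.sup U, fun q hq => Finset.le_sup (f := U) hq (hqU q hq),
    (isSublattice_isTight hf hx).supClosed.finsetSup_mem hne hU⟩

theorem exists_isLeast_isTight [Fintype R] (hf : IsPolymatroidRank f)
    (hx : x ∈ integralPolyhedron f) (huniv : IsTight f x Finset.univ) (p : R) :
    ∃ D, IsLeast {U | p ∈ U ∧ IsTight f x U} D := by
  classical
  have hne : (Finset.univ.filter fun U => p ∈ U ∧ IsTight f x U).Nonempty :=
    ⟨Finset.univ, by simp [huniv]⟩
  have hclosed : InfClosed {U | p ∈ U ∧ IsTight f x U} := fun U hU V hV =>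
    ⟨Finset.mem_inter.2 ⟨hU.1, hV.1⟩, (isSublattice_isTight hf hx).infClosed hU.2 hV.2⟩
  exact ⟨_, hclosed.finsetInf'_mem hne fun U hU => (Finset.mem_filter.1 hU).2,
    fun U hU => Finset.inf'_le id (Finset.mem_filter.2 ⟨Finset.mem_univ U, hU⟩)⟩

theorem add_single_mem_basePolyhedron_iff [Fintype R] :
    x + Pi.single q 1 ∈ basePolyhedron f d ↔
      x + Pi.single q 1 ∈ integralPolyhedron f ∧ ∑ r, x r + 1 = d := by
  simp only [basePolyhedron, Set.mem_ofPred_eq, sum_add_single, Finset.mem_univ, if_true]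

theorem add_single_mem_integralPolyhedron_of_isLeast
    (hy : y + Pi.single q 1 ∈ integralPolyhedron f) {D : Finset R}
    (hD : IsLeast {U | p ∈ U ∧ IsTight f (y + Pi.single q 1) U} D) (hq : q ∈ D) :
    y + Pi.single p 1 ∈ integralPolyhedron f := by
  by_contra hp
  obtain ⟨U, hpU, hU⟩ := exists_isTight_of_add_single_notMem
    (mem_integralPolyhedron_of_add_single hy) hp
  have hyU := hy U
  rw [sum_add_single, hU] at hyU
  have hqU : q ∉ U := fun h => by simp [h] at hyU
  refine hqU (hD.2 ⟨hpU, ?_⟩ hq)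
  rw [IsTight, sum_add_single, hU, if_neg hqU, add_zero]

theorem exists_add_single_mem_integralPolyhedron_of_isTight (hf : IsPolymatroidRank f)
    (hx : x + Pi.single p 1 ∈ integralPolyhedron f) (hy : y ∈ integralPolyhedron f) {D : Finset R}
    (hpD : p ∈ D) (hD : IsTight f y D) :
    ∃ q ∈ D, x q < y q ∧ x + Pi.single q 1 ∈ integralPolyhedron f := by
  by_contra! hno
  obtain ⟨U, hU, hxU⟩ := exists_isTight_superset hf (mem_integralPolyhedron_of_add_single hx)
    (A := D.filter fun q => x q < y q) fun q hq =>
      hno q (Finset.mem_filter.1 hq).1 (Finset.mem_filter.1 hq).2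
  have hDU : ∑ r ∈ D \ U, y r ≤ ∑ r ∈ D \ U, x r := Finset.sum_le_sum fun r hr => by
    obtain ⟨hrD, hrU⟩ := Finset.mem_sdiff.1 hr
    exact not_lt.1 fun h => hrU (hU (Finset.mem_filter.2 ⟨hrD, h⟩))
  have hsub := hf.submodular U D
  have hunion := hx (U ∪ D)
  have hinter := hy (U ∩ D)
  rw [sum_add_single, if_pos (Finset.mem_union_right _ hpD), ← Finset.union_sdiff_self_eq_union,
    Finset.sum_union Finset.disjoint_sdiff, Finset.union_sdiff_self_eq_union] at hunion
  have hDsplit := Finset.sum_inter_add_sum_sdiff D U y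
  rw [Finset.inter_comm] at hDsplit
  unfold IsTight at hxU hD
  omega

variable [Fintype R]

theorem mConvex_basePolyhedron (hf : IsPolymatroidRank f) (d : ℕ) :
    MConvex (basePolyhedron f d) := by
  intro x y p hx hy hyx
  rw [← basePolyhedron_min] at hx hy ⊢
  have hg := hf.min_const d
  have huniv : IsTight (fun U => min (f U) d) y Finset.univ :=
    (hy.1 Finset.univ).antisymm (hy.2 ▸ min_le_right _ _)
  obtain ⟨D, hD⟩ := exists_isLeast_isTight hg hy.1 huniv p
  obtain ⟨q, hqD, hxy, hxq⟩ :=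
    exists_add_single_mem_integralPolyhedron_of_isTight hg hx.1 hy.1 hD.1.1 hD.1.2
  have hqp : q ≠ p := by
    rintro rfl
    exact hyx.not_gt hxy
  obtain ⟨z, rfl⟩ := exists_eq_add_single (Nat.zero_lt_of_lt hxy)
  have hzp := add_single_mem_integralPolyhedron_of_isLeast hy.1 hD hqD
  exact ⟨z, q, rfl, hqp, by simpa [Nat.lt_succ_iff] using hxy,
    add_single_mem_basePolyhedron_iff.2 ⟨hxq, (add_single_mem_basePolyhedron_iff.1 hx).2⟩,
    add_single_mem_basePolyhedron_iff.2 ⟨hzp, (add_single_mem_basePolyhedron_iff.1 hy).2⟩⟩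

theorem exists_exchange_succ (hf : IsPolymatroidRank f) (hx : x ∈ basePolyhedron f d)
    (hy : y ∈ basePolyhedron f (d + 1)) :
    ∃ (z : R → ℕ) (q : R), y = z + Pi.single q 1 ∧ x q ≤ z q ∧ z ∈ basePolyhedron f d ∧
      x + Pi.single q 1 ∈ basePolyhedron f (d + 1) := by
  obtain ⟨q, hxy, hxq⟩ : ∃ q, x q < y q ∧ x + Pi.single q 1 ∈ integralPolyhedron f := by
    by_contra! hno
    obtain ⟨U, hU, hxU⟩ := exists_isTight_superset hf hx.1
      (A := Finset.univ.filter fun q => x q < y q) fun q hq => hno q (Finset.mem_filter.1 hq).2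
    have hyU : ∑ r ∈ U, y r ≤ ∑ r ∈ U, x r := (hy.1 U).trans_eq hxU.symm
    have hyUc : ∑ r ∈ Uᶜ, y r ≤ ∑ r ∈ Uᶜ, x r := Finset.sum_le_sum fun r hr =>
      not_lt.1 fun h => Finset.mem_compl.1 hr (hU (Finset.mem_filter.2 ⟨Finset.mem_univ r, h⟩))
    have hle : ∑ r, y r ≤ ∑ r, x r := by
      simpa only [Finset.sum_add_sum_compl] using add_le_add hyU hyUc
    rw [hx.2, hy.2] at hle
    omega
  obtain ⟨z, rfl⟩ := exists_eq_add_single (Nat.zero_lt_of_lt hxy)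
  obtain ⟨hz, hzd⟩ := add_single_mem_basePolyhedron_iff.1 hy
  exact ⟨z, q, rfl, by simpa [Nat.lt_succ_iff] using hxy,
    ⟨mem_integralPolyhedron_of_add_single hz, Nat.succ_injective hzd⟩,
    add_single_mem_basePolyhedron_iff.2 ⟨hxq, congrArg _ hx.2⟩⟩

theorem exists_add_single_mem_basePolyhedron (hf : IsPolymatroidRank f) (hd : d < f Finset.univ)
    (hx : x ∈ basePolyhedron f d) : ∃ q, x + Pi.single q 1 ∈ basePolyhedron f (d + 1) := by
  by_contra! hno
  obtain ⟨U, hU, hxU⟩ := exists_isTight_superset hf hx.1 (A := Finset.univ) fun q _ h =>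
    hno q (add_single_mem_basePolyhedron_iff.2 ⟨h, congrArg _ hx.2⟩)
  rw [Finset.univ_subset_iff.1 hU, IsTight, hx.2] at hxU
  exact hd.ne hxU

theorem exchangeStable_basePolyhedron_add_single {M : Type*} [AddCommGroup M] [Preorder M]
    [IsOrderedAddMonoid M] {a b : R → ℕ → M} {s : R} (hf : IsPolymatroidRank f)
    (ha : ∀ r, MonotoneOn (a r) (Set.Iio (f {r}))) (hb : ∀ r, MonotoneOn (b r) (Set.Iio (f {r})))
    (hab : ∀ r, ∀ k < f {r}, a r k ≤ b r k) (hx : x ∈ basePolyhedron f d)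
    (h : ExchangeStable (basePolyhedron f d) a b x)
    (hs : x + Pi.single s 1 ∈ basePolyhedron f (d + 1))
    (hmin : ∀ q, x + Pi.single q 1 ∈ basePolyhedron f (d + 1) → b s (x s) ≤ b q (x q)) :
    ExchangeStable (basePolyhedron f (d + 1)) a b (x + Pi.single s 1) := by
  refine exchangeStable_of_isMinOn_splitWeight (y := x) basePolyhedron_subset_Iic hab hs
    fun y hy => ?_
  have hopt := h.isMinOn_splitWeight (mConvex_basePolyhedron hf d) basePolyhedron_subset_Iic
    ha hb hab hx
  obtain ⟨z, q, rfl, hqz, hz, hq⟩ := exists_exchange_succ hf hx hy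
  have hlt {v : R → ℕ} (hv : v + Pi.single q 1 ∈ basePolyhedron f (d + 1)) : v q < f {q} :=
    lt_of_add_single_mem basePolyhedron_subset_Iic hv
  set W := separableCost (splitWeight a b x)
  calc W (x + Pi.single s 1)
    _ = W x + b s (x s) := by simp [W, separableCost_add_single, splitWeight]
    _ ≤ W z + b q (z q) := add_le_add (hopt hz) ((hmin q hq).trans (hb q (hlt hq) (hlt hy) hqz))
    _ = W (z + Pi.single q 1) := by
      simp [W, separableCost_add_single, splitWeight, hqz.not_gt]

end Polymatroid

section StableProfile

open PolymatroidCongestionGame (load)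

/-- The marginal cost `g L k` of a unit, depending on the load `L` of its resource and on the number
`k` of units already held there, is monotone jointly in `L` and in `k < u`. -/
def MonotoneUpTo {M : Type*} [LE M] (u : ℕ) (g : ℕ → ℕ → M) : Prop :=
  ∀ ⦃L L' k k' : ℕ⦄, L ≤ L' → k ≤ k' → k' < u → g L k ≤ g L' k'

theorem MonotoneUpTo.monotoneOn {M : Type*} [Preorder M] {u : ℕ} {g : ℕ → ℕ → M}
    (h : MonotoneUpTo u g) (L : ℕ) : MonotoneOn (g L) (Set.Iio u) :=
  fun _ _ _ hk hjk => h le_rfl hjk hk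

/-- Every player `i` plays in `B i` and cannot gain by moving one unit, if the marginal costs `m`
are evaluated at the loads `l`. The loads are a parameter because they differ from those of the
profile `x` while an additional unit is in the game. -/
def IsStableProfile {N R M : Type*} [DecidableEq R] [LE M] (B : N → Set (R → ℕ))
    (m : N → R → ℕ → ℕ → M) (l : R → ℕ) (x : N → R → ℕ) : Prop :=
  ∀ i, x i ∈ B i ∧
    ExchangeStable (B i) (fun r => m i r (l r)) (fun r => m i r (l r + 1)) (x i)

theorem sum_apply_update_add {N α M : Type*} [Fintype N] [DecidableEq N] [AddCommMonoid M]
    (F : N → α → M) (x : N → α) (i : N) (y : α) :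
    ∑ j, F j (Function.update x i y j) + F i (x i) = ∑ j, F j (x j) + F i y := by
  have hrest : ∑ j ∈ Finset.univ.erase i, F j (Function.update x i y j) =
      ∑ j ∈ Finset.univ.erase i, F j (x j) :=
    Finset.sum_congr rfl fun j hj => by rw [Function.update_of_ne (Finset.ne_of_mem_erase hj)]
  rw [← Finset.add_sum_erase _ _ (Finset.mem_univ i), hrest, Function.update_self,
    ← Finset.add_sum_erase _ (fun j => F j (x j)) (Finset.mem_univ i)]
  abel

theorem isStableProfile_update {N R M : Type*} [DecidableEq N] [DecidableEq R] [LE M]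
    {B : N → Set (R → ℕ)} {m : N → R → ℕ → ℕ → M} {l : R → ℕ} {x : N → R → ℕ} {i : N} {y : R → ℕ}
    (hy : y ∈ B i)
    (h : ExchangeStable (B i) (fun r => m i r (l r)) (fun r => m i r (l r + 1)) y)
    (hne : ∀ j ≠ i, x j ∈ B j ∧
      ExchangeStable (B j) (fun r => m j r (l r)) (fun r => m j r (l r + 1)) (x j)) :
    IsStableProfile B m l (Function.update x i y) :=
  (Function.forall_update_iff x fun j v => v ∈ B j ∧
    ExchangeStable (B j) (fun r => m j r (l r)) (fun r => m j r (l r + 1)) v).2 ⟨⟨hy, h⟩, hne⟩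

variable {N R M : Type*}

section Load

variable [Fintype N] [DecidableEq N]

theorem load_update_add (x : N → R → ℕ) (i : N) (y : R → ℕ) :
    load (Function.update x i y) + x i = load x + y :=
  funext fun r => sum_apply_update_add (fun _ v => v r) x i y

theorem load_update_add_single [DecidableEq R] {x : N → R → ℕ} {i : N} {z l : R → ℕ} {s t : R}
    (hxi : x i = z + Pi.single t 1) (hl : load x = l + Pi.single t 1) :
    load (Function.update x i (z + Pi.single s 1)) = l + Pi.single s 1 := by
  have h := load_update_add x i (z + Pi.single s 1)
  rw [hxi, hl] at h
  refine add_right_cancel (b := z + Pi.single t 1) (h.trans ?_)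
  abel

end Load

variable [DecidableEq R] [AddCommGroup M] {B : N → Set (R → ℕ)} {u : N → R → ℕ}
  {m : N → R → ℕ → ℕ → M} {l : R → ℕ} {x : N → R → ℕ} {i : N} {z : R → ℕ} {s t : R}

theorem IsStableProfile.update_add_single_of_forall_le [DecidableEq N] [Finite R] [Preorder M]
    [IsOrderedAddMonoid M] (hB : ∀ i, MConvex (B i)) (hu : ∀ i, B i ⊆ Set.Iic (u i))
    (hm : ∀ i r, MonotoneUpTo (u i r) (m i r)) (h : IsStableProfile B m l x)
    (hxi : x i = z + Pi.single t 1) (hs : z + Pi.single s 1 ∈ B i)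
    (hmin : ∀ q, z + Pi.single q 1 ∈ B i → m i s (l s + 1) (z s) ≤ m i q (l q + 1) (z q)) :
    IsStableProfile B m l (Function.update x i (z + Pi.single s 1)) := by
  obtain ⟨hmem, hstable⟩ := h i
  rw [hxi] at hmem hstable
  exact isStableProfile_update hs (hstable.add_single_of_forall_le (hB i) (hu i)
    (fun r => (hm i r).monotoneOn _) (fun r => (hm i r).monotoneOn _)
    (fun r k hk => hm i r (Nat.le_succ (l r)) le_rfl hk) hmem hs hmin) fun j _ => h j

variable [Fintype N] [LinearOrder M] [IsOrderedAddMonoid M]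

theorem exists_isStableProfile_of_load_eq_add_single [Finite R] (hB : ∀ i, MConvex (B i))
    (hu : ∀ i, B i ⊆ Set.Iic (u i)) (hm : ∀ i r, MonotoneUpTo (u i r) (m i r))
    (hx : IsStableProfile B m l x) (hl : load x = l + Pi.single t 1) :
    ∃ x, IsStableProfile B m (load x) x := by
  classical
  have := Fintype.ofFinite R
  let F (i : N) : (R → ℕ) → M := separableCost fun r => m i r (l r + 1)
  let S := {x | IsStableProfile B m l x ∧ ∃ t, load x = l + Pi.single t 1}
  have hfin : S.Finite := (Set.finite_Iic u).subset fun x hx i => hu i (hx.1 i).1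
  obtain ⟨x, ⟨hx, t, hl⟩, hmin⟩ :=
    Set.exists_min_image S (fun x => ∑ i, F i (x i)) hfin ⟨x, hx, t, hl⟩
  refine ⟨x, fun i => ⟨(hx i).1, fun z p q hxi hq => ?_⟩⟩
  have hload : m i q (l q + 1) (z q) ≤ m i q (load x q + 1) (z q) :=
    hm i q (by simp [hl]) le_rfl (lt_of_add_single_mem (hu i) hq)
  refine le_trans ?_ hload
  obtain rfl | hpt := eq_or_ne p t
  · obtain ⟨s, hs, hsmin⟩ := Set.exists_min_image {s | z + Pi.single s 1 ∈ B i}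
      (fun s => m i s (l s + 1) (z s)) (Set.toFinite _) ⟨q, by exact hq⟩
    have hpot := hmin _ ⟨hx.update_add_single_of_forall_le hB hu hm hxi hs hsmin, s,
      load_update_add_single hxi hl⟩
    have hF : F i (x i) ≤ F i (z + Pi.single s 1) := by
      have := add_le_add_left hpot (F i (x i))
      rw [sum_apply_update_add F x i] at this
      exact le_of_add_le_add_left this
    have hps : m i p (l p + 1) (z p) ≤ m i s (l s + 1) (z s) := by
      simpa [hxi, F, separableCost_add_single] using hF
    simpa [hl] using hps.trans (hsmin q hq)
  · simpa [hl, hpt] using (hx i).2 hxi hq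

variable [Fintype R]

theorem IsStableProfile.exists_basePolyhedron_add_single [DecidableEq N]
    {f : N → Finset R → ℕ} {d : N → ℕ} (hf : ∀ i, IsPolymatroidRank (f i))
    (hm : ∀ i r, MonotoneUpTo (f i {r}) (m i r)) (hd : d i < f i Finset.univ)
    (hx : IsStableProfile (fun j => basePolyhedron (f j) (d j)) m (load x) x) :
    ∃ x, IsStableProfile (fun j => basePolyhedron (f j) ((d + Pi.single i 1 : N → ℕ) j))
      m (load x) x := by
  obtain ⟨s, hs, hsmin⟩ := Set.exists_min_image
    {s | x i + Pi.single s 1 ∈ basePolyhedron (f i) (d i + 1)}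
    (fun s => m i s (load x s + 1) (x i s)) (Set.toFinite _)
    (exists_add_single_mem_basePolyhedron (hf i) hd (hx i).1)
  have hstable := exchangeStable_basePolyhedron_add_single (hf i)
    (fun r => (hm i r).monotoneOn _) (fun r => (hm i r).monotoneOn _)
    (fun r k hk => hm i r (Nat.le_succ (load x r)) le_rfl hk) (hx i).1 (hx i).2 hs hsmin
  have hxs : IsStableProfile
      (fun j => basePolyhedron (f j) ((d + Pi.single i 1 : N → ℕ) j)) m (load x)
      (Function.update x i (x i + Pi.single s 1)) :=
    isStableProfile_update (by simpa using hs) (by simpa using hstable)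
      fun j hj => by simpa [hj] using hx j
  refine exists_isStableProfile_of_load_eq_add_single (fun j => mConvex_basePolyhedron (hf j) _)
    (fun j => basePolyhedron_subset_Iic) hm hxs (t := s) (add_right_cancel (b := x i) ?_)
  rw [load_update_add]
  abel

theorem exists_isStableProfile_basePolyhedron {f : N → Finset R → ℕ} {d : N → ℕ}
    (hf : ∀ i, IsPolymatroidRank (f i)) (hm : ∀ i r, MonotoneUpTo (f i {r}) (m i r))
    (hd : ∀ i, d i ≤ f i Finset.univ) :
    ∃ x, IsStableProfile (fun i => basePolyhedron (f i) (d i)) m (load x) x := by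
  classical
  induction d using WellFoundedLT.induction with
  | _ d ih =>
  obtain rfl | hne := eq_or_ne d 0
  · exact ⟨0, fun i => ⟨⟨fun U => by simp, by simp⟩,
      fun z p q hz => by simpa using congrFun hz p⟩⟩
  · obtain ⟨i, hi⟩ := Function.ne_iff.1 hne
    obtain ⟨d, rfl⟩ := exists_eq_add_single (Nat.pos_of_ne_zero hi)
    have hle : d ≤ d + Pi.single i 1 := le_self_add
    obtain ⟨x, hx⟩ := ih d (Pi.lt_def.2 ⟨hle, i, by simp⟩) fun j => (hle j).trans (hd j)
    exact hx.exists_basePolyhedron_add_single hf hm (by simpa using hd i)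

end StableProfile

section MarginalCost

/-- The cost of the `(k + 1)`-st unit on a resource with cost function `c` for a player whose
opponents hold `o` units of it. -/
def marginalCost (c : ℕ → ℝ) (o k : ℕ) : ℝ :=
  c (o + k + 1) * (k + 1) - c (o + k) * k

/-- `marginalCost` in terms of the total load `L` of the resource, the new unit included. A load
`L ≤ k`, which is too small to contain the `k + 1` units of the player, is treated as `k + 1` by the
truncated subtraction; this keeps the function monotone. -/
def loadMarginalCost (c : ℕ → ℝ) (L k : ℕ) : ℝ :=
  marginalCost c (L - (k + 1)) k

theorem sum_range_marginalCost (c : ℕ → ℝ) (o n : ℕ) :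
    ∑ k ∈ Finset.range n, marginalCost c o k = c (o + n) * n := by
  simpa [marginalCost, add_assoc] using Finset.sum_range_sub (fun k => c (o + k) * k) n

variable {u : ℕ} {c : ℕ → ℝ}

theorem TruncatedStronglySemiConvex.marginalCost_le_marginalCost
    (h : TruncatedStronglySemiConvex u c) {o o' k k' : ℕ} (ho : o ≤ o') (hk : k ≤ k')
    (hk' : k' < u) : marginalCost c o k ≤ marginalCost c o' k' := by
  simpa [marginalCost, add_assoc] using
    h (k + 1) (k' + 1) o o' (Nat.le_add_left _ _) (Nat.succ_le_succ hk) hk' ho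

theorem TruncatedStronglySemiConvex.monotone_succ (h : TruncatedStronglySemiConvex u c)
    (hu : 0 < u) : Monotone fun n => c (n + 1) := fun a b hab => by
  simpa using h 1 1 a b le_rfl le_rfl hu hab

theorem TruncatedStronglySemiConvex.marginalCost_add_le (h : TruncatedStronglySemiConvex u c)
    (hu : 0 < u) (o j k : ℕ) : marginalCost c (o + j) k ≤ marginalCost c o (k + j) := by
  have hstep : 0 ≤ (c (o + k + j + 1) - c (o + k + j)) * j := by
    obtain rfl | hj := Nat.eq_zero_or_pos j
    · simp
    · refine mul_nonneg (sub_nonneg.2 ?_) j.cast_nonneg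
      obtain ⟨n, hn⟩ := Nat.exists_eq_add_of_lt (show 0 < o + k + j by omega)
      rw [hn]
      exact h.monotone_succ hu (by omega)
  have hdiff : marginalCost c o (k + j) - marginalCost c (o + j) k =
      (c (o + k + j + 1) - c (o + k + j)) * j := by
    simp only [marginalCost, add_right_comm o j k, ← add_assoc, Nat.cast_add]
    ring
  exact sub_nonneg.1 (hdiff ▸ hstep)

theorem TruncatedStronglySemiConvex.monotoneUpTo_loadMarginalCost
    (h : TruncatedStronglySemiConvex u c) :
    MonotoneUpTo u (loadMarginalCost c) := by
  intro L L' k k' hL hk hk'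
  obtain ho | ho := le_or_gt (L - (k + 1)) (L' - (k' + 1))
  · exact h.marginalCost_le_marginalCost ho hk hk'
  · obtain ⟨j, hj⟩ := Nat.exists_eq_add_of_le ho.le
    calc loadMarginalCost c L k
      _ ≤ marginalCost c (L' - (k' + 1)) (k + j) := by
        rw [loadMarginalCost, hj]
        exact h.marginalCost_add_le (Nat.zero_lt_of_lt hk') _ j k
      _ ≤ marginalCost c (L' - (k' + 1)) k' :=
        h.marginalCost_le_marginalCost le_rfl (by omega) hk'

end MarginalCost

namespace PolymatroidCongestionGame

variable {N R : Type*} [Fintype N] [Fintype R] [DecidableEq R]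
  {G : PolymatroidCongestionGame N R} {i : N} {x : N → R → ℕ} {o : R → ℕ}

theorem exchangeStable_marginalCost (ho : load x = o + x i)
    (h : IsStableProfile G.strategies (fun i r => loadMarginalCost (G.cost i r)) (load x) x) :
    ExchangeStable (G.strategies i) (fun r => marginalCost (G.cost i r) (o r))
      (fun r => marginalCost (G.cost i r) (o r)) (x i) := by
  intro z p q hz hq
  obtain rfl | hqp := eq_or_ne q p
  · rfl
  · simpa [loadMarginalCost, ho, hz, hqp, add_assoc] using (h i).2 hz hq

variable [DecidableEq N]

theorem privateCost_update (ho : load x = o + x i) (y : R → ℕ) :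
    G.privateCost i (Function.update x i y) =
      separableCost (fun r => marginalCost (G.cost i r) (o r)) y := by
  have hload : load (Function.update x i y) = o + y := by
    refine add_right_cancel (b := x i) ?_
    rw [load_update_add, ho]
    abel
  simp [privateCost, separableCost, sum_range_marginalCost, hload]

theorem isBestResponse_of_isStableProfile
    (hssc : ∀ r, TruncatedStronglySemiConvex (G.rank i {r}) (G.cost i r))
    (h : IsStableProfile G.strategies (fun i r => loadMarginalCost (G.cost i r)) (load x) x) :
    G.IsBestResponse i x (x i) := by
  obtain ⟨o, ho⟩ : ∃ o, load x = o + x i := le_iff_exists_add'.1 fun r =>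
    Finset.single_le_sum (f := fun j => x j r) (fun _ _ => Nat.zero_le _) (Finset.mem_univ i)
  have hmin : IsMinOn (separableCost fun r => marginalCost (G.cost i r) (o r))
      (G.strategies i) (x i) := (exchangeStable_marginalCost ho h).isMinOn
    (mConvex_basePolyhedron (G.isPolymatroidRank i) _) basePolyhedron_subset_Iic
    (fun r _ _ _ hk' hk => (hssc r).marginalCost_le_marginalCost le_rfl hk hk') (h i).1
  refine ⟨(h i).1, fun y hy => ?_⟩
  rw [privateCost_update ho, privateCost_update ho]
  exact hmin hy

end PolymatroidCongestionGame

theorem mainTheorem1_general {N R : Type*} [Fintype N] [DecidableEq N] [Fintype R] [DecidableEq R]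
    (G : PolymatroidCongestionGame N R)
    (hssc : ∀ (i : N) (r : R), TruncatedStronglySemiConvex (G.rank i {r}) (G.cost i r)) :
    ∃ x : N → R → ℕ, G.IsPureNashEquilibrium x := by
  obtain ⟨x, hx⟩ := exists_isStableProfile_basePolyhedron G.isPolymatroidRank
    (fun i r => (hssc i r).monotoneUpTo_loadMarginalCost) G.demand_le
  exact ⟨x, fun i => (hx i).1,
    fun i => PolymatroidCongestionGame.isBestResponse_of_isStableProfile (hssc i) hx⟩

theorem mainTheorem1 {N R : Type*} [Fintype N] [DecidableEq N] [Fintype R] [DecidableEq R]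
    (G : PolymatroidCongestionGame N R)
    (hnonneg : ∀ (i : N) (r : R) (k : ℕ), 0 ≤ G.cost i r k)
    (hmono : ∀ (i : N) (r : R), Monotone (G.cost i r))
    (hssc : ∀ (i : N) (r : R), TruncatedStronglySemiConvex (G.rank i {r}) (G.cost i r)) :
    ∃ x : N → R → ℕ, G.IsPureNashEquilibrium x :=
  mainTheorem1_general G hssc
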